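/- Let $p$ be a prime, let $k$ be a field of characteristic $p$, let $n\ge 0$, and let $R$ be either the polynomial ring $k[x_1,\dots,x_n]$, in which case assume $[k:k^p]<\infty$, or the formal power series ring $k[[x_1,\dots,x_n]]$, in which case $k$ is arbitrary. For an ideal $I$ of $R$ and an integer $e\ge 1$ let $I^{[p^e]}$ be the ideal generated by the $p^e$-th powers of the elements of $I$. For an ideal $J$ of $R$ let $I_e(J)$ be the smallest ideal $I$ of $R$ with $J\subseteq I^{[p^e]}$, that is, the intersection of all such ideals. For a real number $t$ let the generalized test ideal be $$\tau(J^t)=\bigcup_{e\ge 1} I_e\bigl(J^{\lceil tp^e\rceil}\bigr),$$ where for $t<0$ the exponent $\lceil tp^e\rceil$ is read as $0$ (so that $\tau(J^t)=R$). Then for every $f\in R$ and every real $\varepsilon>0$, $$\mathrm{Jac}(f)=\Bigl(f,\frac{\partial f}{\partial x_1},\dots,\frac{\partial f}{\partial x_n}\Bigr)\subseteq\tau\bigl((f)^{1-\varepsilon}\bigr).$$ -/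

import Mathlib

/-- The Frobenius power `I^[q]`, the ideal generated by the `q`-th powers of the elements of `I`
(used for `q = p ^ e` in characteristic `p`). -/
def frobeniusPower {R : Type*} [CommRing R] (I : Ideal R) (q : ℕ) : Ideal R :=
  Ideal.span ((fun x : R => x ^ q) '' (I : Set R))

/-- The ideal `I_e(J)`: the smallest ideal `I` with `J ≤ I^[p ^ e]`, given as the intersection of
all such ideals. -/
def frobeniusRoot {R : Type*} [CommRing R] (p e : ℕ) (J : Ideal R) : Ideal R :=
  sInf {I : Ideal R | J ≤ frobeniusPower I (p ^ e)}

/-- The intersection is the smallest ideal whenever the latter exists. -/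
theorem frobeniusRoot_eq_of_isLeast {R : Type*} [CommRing R] {p e : ℕ} {J K : Ideal R}
    (hK : IsLeast {I : Ideal R | J ≤ frobeniusPower I (p ^ e)} K) :
    frobeniusRoot p e J = K :=
  hK.isGLB.sInf_eq

/-- The generalized test ideal `τ(J^t)`, literally the union over all positive integers `e` of the
ideals `I_e(J ^ ⌈t p ^ e⌉)`, as a subset of `R`. For `t ≤ 0` the exponent is `0`. -/
def genTestIdeal {R : Type*} [CommRing R] (p : ℕ) (J : Ideal R) (t : ℝ) : Set R :=
  ⋃ e : {e : ℕ // 0 < e}, (frobeniusRoot p e.1 (J ^ ⌈t * (p : ℝ) ^ e.1⌉₊) : Set R)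

/-- The ideal `(f, ∂f/∂x_1, …, ∂f/∂x_n)` of the polynomial ring. -/
noncomputable def polyJacobianIdeal {k : Type*} [Field k] {n : ℕ} (f : MvPolynomial (Fin n) k) :
    Ideal (MvPolynomial (Fin n) k) :=
  Ideal.span (insert f (Set.range fun i : Fin n => MvPolynomial.pderiv i f))

/-- The ideal `(f, ∂f/∂x_1, …, ∂f/∂x_n)` of the power series ring. -/
noncomputable def powerSeriesJacobianIdeal {k : Type*} [Field k] {n : ℕ}
    (f : MvPowerSeries (Fin n) k) : Ideal (MvPowerSeries (Fin n) k) :=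
  Ideal.span (insert f (Set.range fun i : Fin n => MvPowerSeries.pderiv k i f))

/-!
Let `φ` be additive with `φ (a ^ p * b) = a * φ b`. Its `e`-th iterate maps `I^[p ^ e]` into `I`, so
an element `u` with `φ (f ^ (p - 1) * u) = u`, which is then also the image of
`f ^ (p ^ e - 1) * u` under the `e`-th iterate, lies in every `I` with
`f ^ (p ^ e - 1) ∈ I^[p ^ e]`. As `⌈(1 - ε) p ^ e⌉ ≤ p ^ e - 1` for large `e`, such a `u` lies in
`τ(f ^ (1 - ε))`.

For `u = f` any `φ` with `φ 1 = 1` will do. For `u = ∂f/∂x_i` take the Cartier operator in the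
variable `x_i`, which reads off the coefficients at exponents congruent to `p - 1` in `x_i`. The
condition on `u` is then the classical fact that the Cartier operator fixes logarithmic
differentials `df / f`. Since it kills derivatives, and since
`(f + g) ^ (p - 1) d(f + g) - f ^ (p - 1) df - g ^ (p - 1) dg` is the differential of
`((f + g) ^ p - f ^ p - g ^ p) / p`, the `f` that satisfy the condition form a subsemiring. It
contains `x_i` and all series in `x_i ^ p` and the other variables, hence everything.
-/

section CartierLinear

/-- Additive maps `φ` with `φ (a ^ q * b) = a * φ b`, usually called `q⁻¹`-linear or Cartier linear.
They map the Frobenius power `I^[q]` into `I`. -/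
def IsCartierLinear {R : Type*} [Semiring R] (q : ℕ) (φ : R →+ R) : Prop :=
  ∀ a b, φ (a ^ q * b) = a * φ b

/-- Cartier linear maps fixing `1`: the left inverses of Frobenius that make a ring of
characteristic `p` Frobenius split. -/
structure IsFrobeniusSplitting {R : Type*} [Semiring R] (p : ℕ) (φ : R →+ R) : Prop where
  isCartierLinear : IsCartierLinear p φ
  map_one : φ 1 = 1

theorem isCartierLinear_id {R : Type*} [Semiring R] : IsCartierLinear 1 (AddMonoidHom.id R) :=
  fun a b => by simp only [pow_one, AddMonoidHom.id_apply]

theorem IsCartierLinear.comp {R : Type*} [Semiring R] {q r : ℕ} {φ ψ : R →+ R}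
    (hφ : IsCartierLinear q φ) (hψ : IsCartierLinear r ψ) : IsCartierLinear (q * r) (φ.comp ψ) :=
  fun a b => by simp only [AddMonoidHom.comp_apply, pow_mul, hψ (a ^ q) b, hφ a]

theorem IsFrobeniusSplitting.map_pow_sub_one_mul_self {R : Type*} [Semiring R] {p : ℕ}
    {φ : R →+ R} (hφ : IsFrobeniusSplitting p φ) (hp : p ≠ 0) (f : R) :
    φ (f ^ (p - 1) * f) = f := by
  rw [pow_sub_one_mul hp, ← mul_one (f ^ p), hφ.isCartierLinear, hφ.map_one, mul_one]

theorem pow_pow_succ_sub_one {M : Type*} [Monoid M] {p : ℕ} (hp : p ≠ 0) (f : M) (e : ℕ) :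
    f ^ (p ^ (e + 1) - 1) = (f ^ (p ^ e - 1)) ^ p * f ^ (p - 1) := by
  have hle : p ≤ p ^ e * p := Nat.le_mul_of_pos_left p (pow_pos (Nat.pos_of_ne_zero hp) e)
  rw [← pow_mul, ← pow_add, Nat.sub_mul, one_mul, pow_succ]
  congr 1
  omega

theorem IsCartierLinear.exists_map_pow_pow_sub_one_mul {R : Type*} [Semiring R] {p : ℕ}
    {φ : R →+ R} (hφ : IsCartierLinear p φ) (hp : p ≠ 0) {f u : R}
    (hu : φ (f ^ (p - 1) * u) = u) (e : ℕ) :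
    ∃ ψ : R →+ R, IsCartierLinear (p ^ e) ψ ∧ ψ (f ^ (p ^ e - 1) * u) = u := by
  induction e with
  | zero => exact ⟨AddMonoidHom.id R, isCartierLinear_id, by simp⟩
  | succ e ih =>
    obtain ⟨ψ, hψ, hψu⟩ := ih
    refine ⟨ψ.comp φ, hψ.comp hφ, ?_⟩
    rw [pow_pow_succ_sub_one hp, mul_assoc, AddMonoidHom.comp_apply, hφ, hu, hψu]

theorem IsCartierLinear.map_mem_of_mem_frobeniusPower {R : Type*} [CommRing R] {q : ℕ}
    {φ : R →+ R} (hφ : IsCartierLinear q φ) {I : Ideal R} {x : R}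
    (hx : x ∈ frobeniusPower I q) : φ x ∈ I := by
  suffices h : ∀ b, φ (x * b) ∈ I by simpa only [mul_one] using h 1
  induction hx using Submodule.span_induction with
  | mem x hx =>
    obtain ⟨y, hy, rfl⟩ := hx
    exact fun b => (hφ y b).symm ▸ I.mul_mem_right _ hy
  | zero => simp only [zero_mul, map_zero, I.zero_mem, implies_true]
  | add x y _ _ hx hy =>
    exact fun b => by simpa only [add_mul, map_add] using I.add_mem (hx b) (hy b)
  | smul a x _ hx =>
    exact fun b => by simpa only [smul_eq_mul, mul_left_comm, mul_assoc] using hx (a * b)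

theorem IsCartierLinear.map_mem_frobeniusRoot {R : Type*} [CommRing R] {p e : ℕ} {φ : R →+ R}
    (hφ : IsCartierLinear (p ^ e) φ) {J : Ideal R} {x : R} (hx : x ∈ J) :
    φ x ∈ frobeniusRoot p e J :=
  Submodule.mem_sInf.2 fun _ hI => hφ.map_mem_of_mem_frobeniusPower (hI hx)

theorem exists_ceil_one_sub_mul_pow_le {p : ℕ} (hp : 1 < p) {ε : ℝ} (hε : 0 < ε) :
    ∃ e, 0 < e ∧ ⌈(1 - ε) * (p : ℝ) ^ e⌉₊ ≤ p ^ e - 1 := by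
  have hp1 : (1 : ℝ) < p := by exact_mod_cast hp
  obtain ⟨e, he⟩ := pow_unbounded_of_one_lt ε⁻¹ hp1
  refine ⟨e + 1, e.succ_pos, ?_⟩
  have hone : 1 ≤ ε * (p : ℝ) ^ (e + 1) :=
    (inv_le_iff_one_le_mul₀' hε).1 (he.le.trans (pow_le_pow_right₀ hp1.le e.le_succ))
  rw [Nat.ceil_le, Nat.cast_sub (Nat.one_le_pow _ _ (zero_lt_one.trans hp))]
  push_cast
  linarith

theorem span_subset_genTestIdeal {R : Type*} [CommRing R] {p : ℕ} (hp : 1 < p) {f : R}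
    {s : Set R} (hs : ∀ u ∈ s, ∃ φ : R →+ R, IsCartierLinear p φ ∧ φ (f ^ (p - 1) * u) = u)
    {ε : ℝ} (hε : 0 < ε) :
    (Ideal.span s : Set R) ⊆ genTestIdeal p (Ideal.span {f}) (1 - ε) := by
  obtain ⟨e, he, hceil⟩ := exists_ceil_one_sub_mul_pow_le hp hε
  have hf : f ^ (p ^ e - 1) ∈ Ideal.span {f} ^ ⌈(1 - ε) * (p : ℝ) ^ e⌉₊ :=
    Ideal.pow_le_pow_right hceil (Ideal.pow_mem_pow (Ideal.mem_span_singleton_self f) _)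
  refine Set.subset_iUnion_of_subset ⟨e, he⟩
    (SetLike.coe_subset_coe.2 (Ideal.span_le.2 fun u hu => ?_))
  obtain ⟨φ, hφ, hφu⟩ := hs u hu
  obtain ⟨ψ, hψ, hψu⟩ := hφ.exists_map_pow_pow_sub_one_mul (Nat.ne_zero_of_lt hp) hφu e
  exact hψu ▸ hψ.map_mem_frobeniusRoot (Ideal.mul_mem_right u _ hf)

theorem exists_isFrobeniusSplitting (p : ℕ) [Fact p.Prime] (k : Type*) [Field k] [CharP k p] :
    ∃ l : k →+ k, IsFrobeniusSplitting p l := by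
  let F := frobenius k p
  let E : k ≃+* F.fieldRange := F.rangeRestrictFieldEquiv
  obtain ⟨g, hg⟩ := (Algebra.linearMap F.fieldRange k).exists_leftInverse_of_injective
    (LinearMap.ker_eq_bot.2 Subtype.val_injective)
  refine ⟨(E.symm : F.fieldRange →+ k).comp g.toAddMonoidHom, fun a b => ?_, ?_⟩
  · have hab : g (a ^ p * b) = E a * g b := g.map_smul (E a) b
    change E.symm (g (a ^ p * b)) = a * E.symm (g b)
    rw [hab, map_mul, E.symm_apply_apply]
  · have hg1 : g 1 = 1 := LinearMap.congr_fun hg 1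
    change E.symm (g 1) = 1
    rw [hg1, map_one]

end CartierLinear

section LogarithmicDerivative

variable {A R : Type*} [CommRing A] [CommRing R] [Algebra A R] {p : ℕ}

theorem derivation_mvPolynomial_aeval {σ : Type*} [Fintype σ] (D : Derivation A R R)
    (v : σ → R) (P : MvPolynomial σ A) :
    D (MvPolynomial.aeval v P) =
      ∑ i, MvPolynomial.aeval v (MvPolynomial.pderiv i P) * D (v i) := by
  classical
  induction P using MvPolynomial.induction_on with
  | C a => simp
  | add P Q hP hQ => simp only [map_add, hP, hQ, add_mul, Finset.sum_add_distrib]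
  | mul_X P i hP =>
    simp only [map_mul, MvPolynomial.aeval_X, Derivation.leibniz, smul_eq_mul, hP, map_add,
      MvPolynomial.pderiv_X, add_mul, Finset.sum_add_distrib, Finset.mul_sum]
    congr 1
    · rw [Finset.sum_eq_single i (by simp +contextual) (by simp)]
      simp
    · exact Finset.sum_congr rfl fun j _ => by ring

open MvPolynomial in
theorem exists_pderiv_eq_add_pow_sub_X_pow (hp : p.Prime) :
    ∃ H : MvPolynomial (Fin 2) ℤ,
      ∀ i, pderiv i H = (X 0 + X 1) ^ (p - 1) - X i ^ (p - 1) := by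
  obtain ⟨r, hr⟩ := exists_add_pow_prime_eq hp (X 0 : MvPolynomial (Fin 2) ℤ) (X 1)
  have hp0 : (p : MvPolynomial (Fin 2) ℤ) ≠ 0 := by exact_mod_cast hp.ne_zero
  refine ⟨X 0 * X 1 * r, fun i => mul_left_cancel₀ hp0 ?_⟩
  have hH : (p : MvPolynomial (Fin 2) ℤ) * (X 0 * X 1 * r) =
      (X 0 + X 1) ^ p - X 0 ^ p - X 1 ^ p := by
    rw [hr]; ring
  have hadd : pderiv i (X 0 + X 1 : MvPolynomial (Fin 2) ℤ) = 1 := by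
    fin_cases i <;> simp [pderiv_X]
  have hpow : X 0 ^ (p - 1) * pderiv i (X 0) + X 1 ^ (p - 1) * pderiv i (X 1) =
      (X i ^ (p - 1) : MvPolynomial (Fin 2) ℤ) := by
    fin_cases i <;> simp [pderiv_X]
  calc (p : MvPolynomial (Fin 2) ℤ) * pderiv i (X 0 * X 1 * r)
      = pderiv i ((X 0 + X 1) ^ p - X 0 ^ p - X 1 ^ p) := by
        rw [← hH, ← nsmul_eq_mul, ← nsmul_eq_mul, map_nsmul]
    _ = (p : MvPolynomial (Fin 2) ℤ) * ((X 0 + X 1) ^ (p - 1) - X i ^ (p - 1)) := by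
        rw [map_sub, map_sub, pderiv_pow, pderiv_pow, pderiv_pow, hadd, ← hpow]
        ring

theorem exists_add_pow_sub_one_mul_derivation (hp : p.Prime) (D : Derivation A R R) (f g : R) :
    ∃ h, (f + g) ^ (p - 1) * D (f + g) = f ^ (p - 1) * D f + g ^ (p - 1) * D g + D h := by
  obtain ⟨H, hH⟩ := exists_pderiv_eq_add_pow_sub_X_pow hp
  have hD := derivation_mvPolynomial_aeval (D.restrictScalars ℤ) ![f, g] H
  simp only [Derivation.restrictScalars_apply, Fin.sum_univ_two, hH, map_sub, map_pow, map_add,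
    MvPolynomial.aeval_X, Matrix.cons_val_zero, Matrix.cons_val_one] at hD
  exact ⟨MvPolynomial.aeval ![f, g] H, by rw [hD, map_add]; ring⟩

theorem mul_pow_sub_one_mul_derivation (hp : p ≠ 0) (D : Derivation A R R) (f g : R) :
    (f * g) ^ (p - 1) * D (f * g) =
      f ^ p * (g ^ (p - 1) * D g) + g ^ p * (f ^ (p - 1) * D f) := by
  rw [← pow_sub_one_mul hp f, ← pow_sub_one_mul hp g, D.leibniz, smul_eq_mul, smul_eq_mul]
  ring

/-- The subsemiring of those `f` whose logarithmic differential `D f / f` is fixed by a Cartier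
linear map `φ` killing the image of the derivation `D`; the condition `φ (D f / f) = D f / f` is
cleared of denominators using `D f / f = f ^ (p - 1) * D f / f ^ p`. -/
def logDerivativeFixed (hp : p.Prime) (D : Derivation A R R) {φ : R →+ R}
    (hφ : IsCartierLinear p φ) (hD : ∀ h, φ (D h) = 0) : Subsemiring R where
  carrier := {f | φ (f ^ (p - 1) * D f) = D f}
  zero_mem' := by simp
  one_mem' := by simp
  add_mem' {f g} (hf : φ _ = _) (hg : φ _ = _) := by
    obtain ⟨h, hh⟩ := exists_add_pow_sub_one_mul_derivation hp D f g
    change φ _ = _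
    rw [hh, map_add, map_add, hf, hg, hD, add_zero, map_add]
  mul_mem' {f g} (hf : φ _ = _) (hg : φ _ = _) := by
    change φ _ = _
    rw [mul_pow_sub_one_mul_derivation hp.ne_zero, map_add, hφ, hφ, hf, hg, D.leibniz,
      smul_eq_mul, smul_eq_mul]

theorem mem_logDerivativeFixed {hp : p.Prime} {D : Derivation A R R} {φ : R →+ R}
    {hφ : IsCartierLinear p φ} {hD : ∀ h, φ (D h) = 0} {f : R} :
    f ∈ logDerivativeFixed hp D hφ hD ↔ φ (f ^ (p - 1) * D f) = D f := Iff.rfl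

end LogarithmicDerivative

section PowerSeriesContract

open MvPowerSeries

variable {σ k : Type*} {p : ℕ}

/-- The operator reading off the coefficients at the exponents `p • γ + s` and applying `l` to them.
For `s = 0` it extends a Frobenius splitting `l` from `k` to power series; for
`s = Finsupp.single i (p - 1)` it is the Cartier operator in the variable `X i`. -/
noncomputable def powerSeriesContract [Semiring k] (p : ℕ) (l : k →+ k) (s : σ →₀ ℕ) :
    MvPowerSeries σ k →+ MvPowerSeries σ k where
  toFun g := fun γ => l (coeff (p • γ + s) g)
  map_zero' := funext fun _ => by rw [map_zero, map_zero]; rfl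
  map_add' f g := funext fun _ => by rw [map_add, map_add]; rfl

theorem coeff_powerSeriesContract [Semiring k] (l : k →+ k) (s γ : σ →₀ ℕ)
    (g : MvPowerSeries σ k) :
    coeff γ (powerSeriesContract p l s g) = l (coeff (p • γ + s) g) := rfl

theorem exists_eq_smul_of_add_eq_smul_add {s u v γ : σ →₀ ℕ} (hs : ∀ i, s i < p)
    (hu : ∀ i, p ∣ u i) (huv : u + v = p • γ + s) :
    ∃ x y, x + y = γ ∧ p • x = u ∧ p • y + s = v := by
  let x : σ →₀ ℕ := u.mapRange (· / p) (Nat.zero_div p)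
  have hpx : p • x = u := Finsupp.ext fun i => Nat.mul_div_cancel' (hu i)
  have hx : x ≤ γ := fun i => by
    have huvi : p * x i + v i = p * γ i + s i := DFunLike.congr_fun (hpx.symm ▸ huv) i
    have hlt : p * x i < p * (γ i + 1) := by have := hs i; rw [mul_add]; omega
    exact Nat.lt_succ_iff.1 (lt_of_mul_lt_mul_left hlt p.zero_le)
  refine ⟨x, γ - x, add_tsub_cancel_of_le hx, hpx, add_left_cancel (a := u) ?_⟩
  rw [huv, ← hpx, ← add_assoc, ← smul_add, add_tsub_cancel_of_le hx]

theorem coeff_smul_add_expand_mul [DecidableEq σ] [CommRing k] (hp : p ≠ 0) {s : σ →₀ ℕ}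
    (hs : ∀ i, s i < p) (γ : σ →₀ ℕ) (a b : MvPowerSeries σ k) :
    coeff (p • γ + s) (expand p hp a * b) =
      ∑ x ∈ Finset.HasAntidiagonal.antidiagonal γ, coeff x.1 a * coeff (p • x.2 + s) b := by
  rw [coeff_mul]
  refine (Finset.sum_of_injOn (fun x => (p • x.1, p • x.2 + s)) ?_ ?_ ?_ ?_).symm
  · rintro ⟨x, y⟩ _ ⟨x', y'⟩ _ h
    simpa [nsmul_right_inj hp] using h
  · rintro ⟨x, y⟩ h
    rw [Finset.mem_coe, Finset.HasAntidiagonal.mem_antidiagonal] at h ⊢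
    rw [← h, smul_add, add_assoc]
  · rintro ⟨u, v⟩ huv hn
    obtain ⟨i, hi⟩ : ∃ i, ¬ p ∣ u i := by
      by_contra! hu
      obtain ⟨x, y, hxy, rfl, rfl⟩ :=
        exists_eq_smul_of_add_eq_smul_add hs hu (Finset.HasAntidiagonal.mem_antidiagonal.1 huv)
      exact hn ⟨(x, y), Finset.mem_coe.2 (Finset.HasAntidiagonal.mem_antidiagonal.2 hxy), rfl⟩
    rw [coeff_expand_of_not_dvd p hp a hi, zero_mul]
  · rintro ⟨x, y⟩ _
    rw [coeff_expand_smul]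

theorem isCartierLinear_powerSeriesContract [hp : Fact p.Prime] [CommRing k] [CharP k p]
    {l : k →+ k} (hl : IsCartierLinear p l) {s : σ →₀ ℕ} (hs : ∀ i, s i < p) :
    IsCartierLinear p (powerSeriesContract p l s) := by
  classical
  intro a b
  ext γ
  rw [← map_frobenius_expand p hp.out.ne_zero, map_expand, coeff_powerSeriesContract,
    coeff_smul_add_expand_mul _ hs, coeff_mul, map_sum]
  refine Finset.sum_congr rfl fun x _ => ?_
  rw [coeff_map, frobenius_def, hl, coeff_powerSeriesContract]

theorem powerSeriesContract_zero_one [Semiring k] {l : k →+ k} (hp : p ≠ 0) (hl : l 1 = 1) :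
    powerSeriesContract p l (0 : σ →₀ ℕ) 1 = 1 := by
  classical
  ext γ
  rw [coeff_powerSeriesContract, coeff_one, coeff_one]
  by_cases h : γ = 0 <;> simp [h, hp, hl]

theorem isFrobeniusSplitting_powerSeriesContract [hp : Fact p.Prime] [CommRing k] [CharP k p]
    {l : k →+ k} (hl : IsFrobeniusSplitting p l) :
    IsFrobeniusSplitting p (powerSeriesContract p l (0 : σ →₀ ℕ)) :=
  ⟨isCartierLinear_powerSeriesContract hl.isCartierLinear fun _ => hp.out.pos,
    powerSeriesContract_zero_one hp.out.ne_zero hl.map_one⟩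

theorem single_sub_one_lt (hp : p ≠ 0) (i j : σ) : Finsupp.single i (p - 1) j < p := by
  classical
  rw [Finsupp.single_apply]
  split_ifs <;> omega

theorem powerSeriesContract_single_X_pow [Semiring k] {l : k →+ k} (hp : p ≠ 0) (hl : l 1 = 1)
    (i : σ) : powerSeriesContract p l (Finsupp.single i (p - 1)) (X i ^ (p - 1)) = 1 := by
  classical
  ext γ
  rw [coeff_powerSeriesContract, coeff_X_pow, coeff_one]
  by_cases h : γ = 0 <;> simp [h, hp, hl]

theorem powerSeriesContract_single_pderiv [CommSemiring k] [CharP k p] (hp : p ≠ 0) (l : k →+ k)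
    (i : σ) (h : MvPowerSeries σ k) :
    powerSeriesContract p l (Finsupp.single i (p - 1)) (pderiv k i h) = 0 := by
  ext γ
  have hexp : (p • γ + Finsupp.single i (p - 1)) i + 1 = p * (γ i + 1) := by
    simp only [Finsupp.add_apply, Finsupp.smul_apply, smul_eq_mul, Finsupp.single_eq_same, mul_add]
    omega
  rw [coeff_powerSeriesContract, coeff_pderiv, ← Nat.cast_succ, Nat.succ_eq_add_one, hexp,
    Nat.cast_mul, CharP.cast_eq_zero, zero_mul, mul_zero, map_zero, map_zero]

/-- The coefficients `f_j` in the decomposition of `f` as a sum of `f_j * X i ^ j` over `j < p`,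
where only exponents of `X i` divisible by `p` occur in `f_j`. -/
noncomputable def residueComponent [Semiring k] (p : ℕ) (i : σ) (j : ℕ) (f : MvPowerSeries σ k) :
    MvPowerSeries σ k :=
  fun γ => if p ∣ γ i then coeff (γ + Finsupp.single i j) f else 0

theorem coeff_residueComponent [Semiring k] (i : σ) (j : ℕ) (f : MvPowerSeries σ k)
    (γ : σ →₀ ℕ) : coeff γ (residueComponent p i j f) =
      if p ∣ γ i then coeff (γ + Finsupp.single i j) f else 0 := rfl

theorem pderiv_residueComponent [CommSemiring k] [CharP k p] (i : σ) (j : ℕ)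
    (f : MvPowerSeries σ k) : pderiv k i (residueComponent p i j f) = 0 := by
  ext γ
  rw [coeff_pderiv, coeff_residueComponent, map_zero]
  split_ifs with h
  · rw [← Nat.cast_succ, (CharP.cast_eq_zero_iff k p _).2 (by simpa using h), mul_zero]
  · exact zero_mul _

theorem sum_residueComponent_mul_X_pow [Semiring k] (hp : p ≠ 0) (i : σ)
    (f : MvPowerSeries σ k) :
    ∑ j ∈ Finset.range p, residueComponent p i j f * X i ^ j = f := by
  classical
  ext γ
  have hlt : γ i % p < p := Nat.mod_lt _ (Nat.pos_of_ne_zero hp)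
  have hle : Finsupp.single i (γ i % p) ≤ γ := by simpa using Nat.mod_le (γ i) p
  rw [map_sum, Finset.sum_eq_single_of_mem (γ i % p) (Finset.mem_range.2 hlt)]
  · rw [X_pow_eq, coeff_mul_monomial, if_pos hle, coeff_residueComponent,
      if_pos (by simpa using Nat.dvd_sub_mod (γ i)), mul_one, tsub_add_cancel_of_le hle]
  · intro j hj hne
    rw [X_pow_eq, coeff_mul_monomial, mul_one]
    split_ifs with h
    · rw [coeff_residueComponent, if_neg]
      intro hdvd
      have hmod : j ≡ γ i [MOD p] :=
        (Nat.modEq_iff_dvd' (by simpa using h)).2 (by simpa using hdvd)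
      exact hne ((Nat.mod_eq_of_lt (Finset.mem_range.1 hj)).symm.trans hmod)
    · rfl

theorem powerSeriesContract_pow_sub_one_mul_pderiv [hp : Fact p.Prime] [CommRing k] [CharP k p]
    {l : k →+ k} (hl : IsFrobeniusSplitting p l) (i : σ) (f : MvPowerSeries σ k) :
    powerSeriesContract p l (Finsupp.single i (p - 1)) (f ^ (p - 1) * pderiv k i f) =
      pderiv k i f := by
  have hp0 : p ≠ 0 := hp.out.ne_zero
  let S := logDerivativeFixed hp.out (pderiv k i)
    (isCartierLinear_powerSeriesContract hl.isCartierLinear (single_sub_one_lt hp0 i))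
    (powerSeriesContract_single_pderiv hp0 l i)
  have hX : X i ∈ S := mem_logDerivativeFixed.2 <| by
    rw [pderiv_X_self, mul_one, powerSeriesContract_single_X_pow hp0 hl.map_one]
  have hcomponent (j : ℕ) : residueComponent p i j f ∈ S := mem_logDerivativeFixed.2 <| by
    rw [pderiv_residueComponent, mul_zero, map_zero]
  have hf : f ∈ S := by
    rw [← sum_residueComponent_mul_X_pow hp0 i f]
    exact sum_mem fun j _ => mul_mem (hcomponent j) (pow_mem hX j)
  exact mem_logDerivativeFixed.1 hf

end PowerSeriesContract

section PolyContract

variable {σ k : Type*} {p : ℕ}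

/-- The restriction of `powerSeriesContract` to polynomials. -/
noncomputable def polyContract [CommSemiring k] (hp : p ≠ 0) (l : k →+ k) (s : σ →₀ ℕ) :
    MvPolynomial σ k →+ MvPolynomial σ k where
  toFun g := AddMonoidAlgebra.ofCoeff <| Finsupp.mapRange l (map_zero l) <|
    Finsupp.comapDomain (fun γ => p • γ + s) (AddMonoidAlgebra.coeff g)
      ((add_left_injective s).comp (nsmul_right_injective hp)).injOn
  map_zero' := MvPolynomial.ext _ _ fun _ => map_zero l
  map_add' _ _ := MvPolynomial.ext _ _ fun _ => map_add l _ _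

theorem coe_polyContract [CommSemiring k] (hp : p ≠ 0) (l : k →+ k) (s : σ →₀ ℕ)
    (g : MvPolynomial σ k) :
    (polyContract hp l s g : MvPowerSeries σ k) = powerSeriesContract p l s g :=
  MvPowerSeries.ext fun _ => rfl

variable [hp : Fact p.Prime] [CommRing k] [CharP k p] {l : k →+ k}

theorem isCartierLinear_polyContract (hl : IsCartierLinear p l) {s : σ →₀ ℕ}
    (hs : ∀ i, s i < p) : IsCartierLinear p (polyContract hp.out.ne_zero l s) := fun a b => by
  apply MvPolynomial.coe_injective σ k
  rw [coe_polyContract, MvPolynomial.coe_mul, MvPolynomial.coe_mul, MvPolynomial.coe_pow,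
    isCartierLinear_powerSeriesContract hl hs, coe_polyContract]

theorem isFrobeniusSplitting_polyContract (hl : IsFrobeniusSplitting p l) :
    IsFrobeniusSplitting p (polyContract hp.out.ne_zero l (0 : σ →₀ ℕ)) where
  isCartierLinear := isCartierLinear_polyContract hl.isCartierLinear fun _ => hp.out.pos
  map_one := by
    apply MvPolynomial.coe_injective σ k
    rw [coe_polyContract, MvPolynomial.coe_one,
      (isFrobeniusSplitting_powerSeriesContract hl).map_one]

theorem polyContract_pow_sub_one_mul_pderiv (hl : IsFrobeniusSplitting p l) (i : σ)
    (f : MvPolynomial σ k) :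
    polyContract hp.out.ne_zero l (Finsupp.single i (p - 1))
      (f ^ (p - 1) * MvPolynomial.pderiv i f) = MvPolynomial.pderiv i f := by
  apply MvPolynomial.coe_injective σ k
  rw [coe_polyContract, MvPolynomial.coe_mul, MvPolynomial.coe_pow, ← MvPowerSeries.pderiv_coe,
    powerSeriesContract_pow_sub_one_mul_pderiv hl]

end PolyContract

theorem mainTheorem1_general {p : ℕ} [hp : Fact p.Prime] {σ k : Type*} [CommRing k] [CharP k p]
    {l : k →+ k} (hl : IsFrobeniusSplitting p l) {ε : ℝ} (hε : 0 < ε) :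
    (∀ f : MvPolynomial σ k,
      (Ideal.span (insert f (Set.range fun i => MvPolynomial.pderiv i f)) :
        Set (MvPolynomial σ k)) ⊆ genTestIdeal p (Ideal.span {f}) (1 - ε)) ∧
    (∀ f : MvPowerSeries σ k,
      (Ideal.span (insert f (Set.range fun i => MvPowerSeries.pderiv k i f)) :
        Set (MvPowerSeries σ k)) ⊆ genTestIdeal p (Ideal.span {f}) (1 - ε)) := by
  have hp0 : p ≠ 0 := hp.out.ne_zero
  refine ⟨fun f => span_subset_genTestIdeal hp.out.one_lt ?_ hε,
    fun f => span_subset_genTestIdeal hp.out.one_lt ?_ hε⟩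
  · rintro _ (rfl | ⟨i, rfl⟩)
    · have hsplit := isFrobeniusSplitting_polyContract (σ := σ) hl
      exact ⟨_, hsplit.isCartierLinear, hsplit.map_pow_sub_one_mul_self hp0 _⟩
    · exact ⟨_, isCartierLinear_polyContract hl.isCartierLinear (single_sub_one_lt hp0 i),
        polyContract_pow_sub_one_mul_pderiv hl i f⟩
  · rintro _ (rfl | ⟨i, rfl⟩)
    · have hsplit := isFrobeniusSplitting_powerSeriesContract (σ := σ) hl
      exact ⟨_, hsplit.isCartierLinear, hsplit.map_pow_sub_one_mul_self hp0 _⟩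
    · exact ⟨_, isCartierLinear_powerSeriesContract hl.isCartierLinear (single_sub_one_lt hp0 i),
        powerSeriesContract_pow_sub_one_mul_pderiv hl i f⟩

theorem mainTheorem1 (p : ℕ) [Fact p.Prime] (k : Type*) [Field k] [CharP k p] (n : ℕ) :
    (Module.Finite (frobenius k p).fieldRange k →
      ∀ (f : MvPolynomial (Fin n) k) (ε : ℝ), 0 < ε →
        (polyJacobianIdeal f : Set (MvPolynomial (Fin n) k)) ⊆
          genTestIdeal p (Ideal.span {f}) (1 - ε)) ∧
    (∀ (f : MvPowerSeries (Fin n) k) (ε : ℝ), 0 < ε →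
      (powerSeriesJacobianIdeal f : Set (MvPowerSeries (Fin n) k)) ⊆
        genTestIdeal p (Ideal.span {f}) (1 - ε)) := by
  obtain ⟨l, hl⟩ := exists_isFrobeniusSplitting p k
  exact ⟨fun _ f _ hε => (mainTheorem1_general hl hε).1 f,
    fun f _ hε => (mainTheorem1_general hl hε).2 f⟩
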